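/- Let $K$ and $M$ be integers with $0\le M<K$, and put $g=\lceil K/(M+1)\rceil$. **Setting.** For a message length $t\ge 1$, one server holds messages $X=(X_1,\dots,X_K)$, independent and uniform on $\mathbb F_{2^t}$. A user has a random pair $(\mathbf W,\mathbf S)$, independent of $X$, consisting of a demand index $\mathbf W\in[K]$ and a side-information index set $\mathbf S\subseteq[K]\setminus\{\mathbf W\}$ with $|\mathbf S|=M$. A *scheme* consists of queries and answers: when $(\mathbf W,\mathbf S)=(W,S)$, the user, who knows $X_S=(X_j)_{j\in S}$, sends a query $Q^{[W,S]}$ that is a (possibly randomized) function of $(W,S,X_S)$, and the server returns an answer $A^{[W,S]}$ that is a deterministic function of the query and of $X$; queries and answers are discrete. The scheme is * *decodable* if $H(X_W\mid A^{[W,S]},X_S)=0$ for every $(W,S)$ of positive probability; * *decodable with the query* if $H(X_W\mid Q^{[W,S]},A^{[W,S]},X_S)=0$ for every such $(W,S)$; * *$W$-private* if $I(\mathbf W;\,Q^{[\mathbf W,\mathbf S]},A^{[\mathbf W,\mathbf S]},X_1,\dots,X_K)=0$. Its rate at $(W,S)$ is $t/H(A^{[W,S]})$ (entropy in bits), and its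 rate is the minimum of these over all $(W,S)$ of positive probability. The *capacity* for a law of $(\mathbf W,\mathbf S)$ is the supremum of the rates of all decodable $W$-private schemes, over all $t\ge1$; the *capacity with the query* is the same supremum over the schemes that are decodable with the query and $W$-private. **Theorem.** 1. Let $\mathbf W$ be uniform on $[K]$ and, given $\mathbf W$, let $\mathbf S$ be uniform among the $M$-subsets of $[K]\setminus\{\mathbf W\}$; that is, $P(\mathbf W=W,\mathbf S=S)=\frac{1}{(K-M)\binom KM}$ if $W\notin S$ and $|S|=M$, and $0$ otherwise. Then the capacity and the capacity with the query are both equal to $\lceil K/(M+1)\rceil^{-1}$. Moreover, for every $t\ge1$ there is a $W$-private scheme, decodable with the query, whose rate at every $(W,S)$ of positive probability is exactly $1/g$. 2. Let $(\mathbf W,\mathbf S)$ have any law with $\mathbf W\notin\mathbf S$ and $|\mathbf S|=M$ almost surely and $P(\mathbf W=W)>0$ for every $W\in[K]$. Then for every $t\ge 1$, every $W$-private scheme that is decodable with the query (in particular every decodable one) has rate at most $1/g$ at every $(W,S)$ of positive probability. -/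

import Mathlib

open scoped ENNReal

noncomputable section

namespace PIRSI

/-- Shannon entropy, in bits, of a discrete law. -/
def entropy {α : Type*} (p : PMF α) : ℝ≥0∞ :=
  ∑' a, ENNReal.ofReal (Real.negMulLog (p a).toReal / Real.log 2)

/-- Conditional entropy `H(U | V)`, in bits, where `p` is the joint law of `(U, V)`: the sum of
`p(u, v) log₂ (p_V(v) / p(u, v))`, all of whose terms are nonnegative. -/
def condEntropy {α β : Type*} (p : PMF (α × β)) : ℝ≥0∞ :=
  ∑' z : α × β, ENNReal.ofReal
    ((p z).toReal * Real.logb 2 ((p.map Prod.snd z.2).toReal / (p z).toReal))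

/-- Mutual information `I(U; V)` (in nats), where `p` is the joint law of `(U, V)`: the
Kullback-Leibler divergence of the joint law from the product of its marginals. -/
def mutualInfo {α β : Type*} (p : PMF (α × β)) : ℝ≥0∞ :=
  letI : MeasurableSpace α := ⊤
  letI : MeasurableSpace β := ⊤
  InformationTheory.klDiv p.toMeasure
    ((p.map Prod.fst).toMeasure.prod (p.map Prod.snd).toMeasure)

/-- A message of `t` bits. -/
abbrev Msg (t : ℕ) : Type := GaloisField 2 t

/-- The database of `K` messages. -/
abbrev Database (K t : ℕ) : Type := Fin K → Msg t

instance (t : ℕ) : Fintype (Msg t) := Fintype.ofFinite _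

/-- The messages are independent and uniform. -/
def databaseLaw (K t : ℕ) : PMF (Database K t) := PMF.uniformOfFintype _

/-- The side information `X_S`. -/
def sideInfo {K t : ℕ} (S : Finset (Fin K)) (x : Database K t) : S → Msg t := fun i => x i

/-- A single-round, single-server scheme with side information: the query is a stochastic function
of `W`, `S` and `X_S`; the answer is a deterministic function of the query and the database. -/
structure Scheme (K t : ℕ) where
  Query : Type
  Answer : Type
  query : (W : Fin K) → (S : Finset (Fin K)) → (S → Msg t) → PMF Query
  answer : Query → Database K t → Answer

namespace Scheme

variable {K t : ℕ} (σ : Scheme K t)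

/-- The joint law of the query and the database when the demand index is `W` and the side
information index set is `S`. -/
def queryLaw (W : Fin K) (S : Finset (Fin K)) : PMF (σ.Query × Database K t) :=
  (databaseLaw K t).bind fun x => (σ.query W S (sideInfo S x)).map fun q => (q, x)

/-- The law of the answer `A^[W,S]`. -/
def answerLaw (W : Fin K) (S : Finset (Fin K)) : PMF σ.Answer :=
  (σ.queryLaw W S).map fun z => σ.answer z.1 z.2

/-- The joint law of `X_W` and `(A^[W,S], X_S)`. -/
def decodingLaw (W : Fin K) (S : Finset (Fin K)) : PMF (Msg t × (σ.Answer × (S → Msg t))) :=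
  (σ.queryLaw W S).map fun z => (z.2 W, (σ.answer z.1 z.2, sideInfo S z.2))

/-- The joint law of `X_W` and `(Q^[W,S], A^[W,S], X_S)`. -/
def decodingLawWithQuery (W : Fin K) (S : Finset (Fin K)) :
    PMF (Msg t × (σ.Query × σ.Answer × (S → Msg t))) :=
  (σ.queryLaw W S).map fun z => (z.2 W, (z.1, σ.answer z.1 z.2, sideInfo S z.2))

/-- The joint law of the random demand index and of what the server sees (query, answer and
database), when `(W, S)` has law `p` and is independent of the database. -/
def serverLaw (p : PMF (Fin K × Finset (Fin K))) :
    PMF (Fin K × (σ.Query × σ.Answer × Database K t)) :=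
  p.bind fun ws => (σ.queryLaw ws.1 ws.2).map fun z => (ws.1, (z.1, σ.answer z.1 z.2, z.2))

/-- `H(X_W | A^[W,S], X_S) = 0` for all possible `W` and `S`. -/
def Decodable (p : PMF (Fin K × Finset (Fin K))) : Prop :=
  ∀ ws ∈ p.support, condEntropy (σ.decodingLaw ws.1 ws.2) = 0

/-- `H(X_W | Q^[W,S], A^[W,S], X_S) = 0` for all possible `W` and `S`: the user may also use the
query it has sent. -/
def DecodableWithQuery (p : PMF (Fin K × Finset (Fin K))) : Prop :=
  ∀ ws ∈ p.support, condEntropy (σ.decodingLawWithQuery ws.1 ws.2) = 0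

/-- `W`-privacy: `I(W; Q, A, X_1, …, X_K) = 0`. -/
def WPrivate (p : PMF (Fin K × Finset (Fin K))) : Prop :=
  mutualInfo (σ.serverLaw p) = 0

/-- The rate `t / H(A^[W,S])` for given `W` and `S`. -/
def rateAt (W : Fin K) (S : Finset (Fin K)) : ℝ≥0∞ :=
  (t : ℝ≥0∞) / entropy (σ.answerLaw W S)

/-- The rate guaranteed by the scheme for all possible `W` and `S`. -/
def rate (p : PMF (Fin K × Finset (Fin K))) : ℝ≥0∞ :=
  ⨅ ws ∈ p.support, σ.rateAt ws.1 ws.2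

end Scheme

/-- The capacity: the supremum of the rates of all `W`-private schemes, over all message lengths,
where the user decodes from the answer and the side information. -/
def capacity {K : ℕ} (p : PMF (Fin K × Finset (Fin K))) : ℝ≥0∞ :=
  ⨆ (t : ℕ) (_ : 1 ≤ t) (σ : Scheme K t) (_ : σ.Decodable p) (_ : σ.WPrivate p), σ.rate p

/-- The capacity when the user decodes from the query, the answer and the side information. -/
def capacityWithQuery {K : ℕ} (p : PMF (Fin K × Finset (Fin K))) : ℝ≥0∞ :=
  ⨆ (t : ℕ) (_ : 1 ≤ t) (σ : Scheme K t) (_ : σ.DecodableWithQuery p) (_ : σ.WPrivate p), σ.rate p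

/-- The pairs of a demand index and an `M`-set of side information indices avoiding it. -/
def admissiblePairs (K M : ℕ) : Finset (Fin K × Finset (Fin K)) :=
  Finset.univ.filter fun ws => ws.1 ∉ ws.2 ∧ ws.2.card = M

theorem admissiblePairs_nonempty {K M : ℕ} (h : M < K) : (admissiblePairs K M).Nonempty := by
  have hc : M ≤ (Finset.univ.erase (⟨0, by omega⟩ : Fin K)).card := by
    rw [Finset.card_erase_of_mem (Finset.mem_univ _), Finset.card_fin]; omega
  obtain ⟨S, hS, hcard⟩ := Finset.exists_subset_card_eq hc
  refine ⟨(⟨0, by omega⟩, S), ?_⟩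
  simp only [admissiblePairs, Finset.mem_filter, Finset.mem_univ, true_and]
  exact ⟨fun h0 => by simpa using hS h0, hcard⟩

/-- The demand index is uniform and, given it, the side information index set is uniform among the
`M`-sets avoiding it; equivalently, the pair is uniform on the admissible pairs. -/
def uniformPairLaw (K M : ℕ) (h : M < K) : PMF (Fin K × Finset (Fin K)) :=
  PMF.uniformOfFinset (admissiblePairs K M) (admissiblePairs_nonempty h)

theorem card_admissiblePairs (K M : ℕ) :
    (admissiblePairs K M).card = (K - M) * K.choose M := by
  have h : admissiblePairs K M = (Finset.univ : Finset (Fin K)).biUnion fun w =>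
      (Finset.powersetCard M (Finset.univ.erase w)).image fun S => (w, S) := by
    ext ⟨w, S⟩
    simp only [admissiblePairs, Finset.mem_filter, Finset.mem_univ, true_and, Finset.mem_biUnion,
      Finset.mem_image, Finset.mem_powersetCard, Prod.mk.injEq]
    constructor
    · rintro ⟨h1, h2⟩
      refine ⟨w, S, ⟨fun i hi => ?_, h2⟩, rfl, rfl⟩
      simp only [Finset.mem_erase, Finset.mem_univ, and_true]
      rintro rfl
      exact h1 hi
    · rintro ⟨w', S', ⟨h1, h2⟩, rfl, rfl⟩
      exact ⟨fun hw => by simpa using h1 hw, h2⟩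
  rw [h, Finset.card_biUnion]
  · have : ∀ w : Fin K, ((Finset.powersetCard M (Finset.univ.erase w)).image
        fun S => (w, S)).card = (K - 1).choose M := by
      intro w
      rw [Finset.card_image_of_injective _ (fun a b hab => by simpa using hab),
        Finset.card_powersetCard, Finset.card_erase_of_mem (Finset.mem_univ _), Finset.card_fin]
    simp only [this, Finset.sum_const, Finset.card_fin, smul_eq_mul]
    rcases K with _ | n
    · simp
    · rw [Nat.add_sub_cancel, Nat.mul_comm (n + 1 - M), ← Nat.choose_mul_succ_eq, Nat.mul_comm]
  · intro a _ b _ hab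
    rw [Function.onFun, Finset.disjoint_left]
    rintro x hx hy
    simp only [Finset.mem_image] at hx hy
    obtain ⟨_, _, rfl⟩ := hx
    obtain ⟨_, _, hh⟩ := hy
    exact hab (Prod.mk.inj hh).1.symm

theorem uniformPairLaw_apply (K M : ℕ) (h : M < K) (W : Fin K) (S : Finset (Fin K)) :
    uniformPairLaw K M h (W, S) =
      if W ∉ S ∧ S.card = M then (((K - M) * K.choose M : ℕ) : ℝ≥0∞)⁻¹ else 0 := by
  rw [uniformPairLaw, PMF.uniformOfFinset_apply, card_admissiblePairs]
  simp [admissiblePairs]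

end PIRSI

end

/-! Converse. Privacy makes the query independent of the demand and of the database together: given
`(W, q)` the weight of `q` cannot depend on `X_W`, because `W ∉ S`; being a function of `x` common
to all demands, it depends on no coordinate (`WPrivate.exists_demandWeight_eq`). Fix `q`. The answer
is then a function of `x` from which every coordinate `W` is recoverable with the help of a random
set `S` of `M` coordinates, whose weights depend on `x_S` only and have constant sum. Such a
function takes no value too often. Fix a set of coordinates, choose `W` outside it, average over
`S`, and reveal `x_S`: the answer then determines `x_W`, so each answer occupies one fibre of `x_W`,
and a factor `|F|` is gained for at most `M + 1` coordinates spent (`boxCount_mul_pow_le`).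
Averaging over queries bounds every answer probability by `2 ^ (-g t)`, and Shannon entropy is at
least min-entropy.

Achievability. Arrange the messages by a random permutation into `g` blocks of length at most `M +
1`, so that the other messages of the demand's block are side information, and send the block sums.
For each demand and permutation exactly one `S` fits, and the number of fitting permutations is the
same for all pairs, so the permutation is independent of the demand. To decode without the query,
the server repeats it in the answer; this costs a number of bits independent of `t`, negligible as
`t → ∞`. -/

open scoped ENNReal

namespace PIRSI

/-! ### Counting points of a box with a given answer -/

section Counting

variable {ι F A : Type*} [Fintype ι] [DecidableEq ι] [Fintype F] [DecidableEq A]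

/-- Exchanging the coordinates in `S` of two vectors. -/
def exchangeEquiv (S : Finset ι) : ((ι → F) × (ι → F)) ≃ ((ι → F) × (ι → F)) where
  toFun z := (S.piecewise z.1 z.2, S.piecewise z.2 z.1)
  invFun z := (S.piecewise z.1 z.2, S.piecewise z.2 z.1)
  left_inv z := by
    ext i <;> by_cases hi : i ∈ S <;> simp [hi]
  right_inv z := by
    ext i <;> by_cases hi : i ∈ S <;> simp [hi]

/-- Exchanging the `S`-coordinates of `z` and `z'` is a bijection of pairs, after which the second
vector is free. Sums over full vectors thus replace sums over partial ones, at the price of a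
constant factor. -/
theorem sum_sum_piecewise {N : Type*} [NonAssocSemiring N] (S : Finset ι) (f : (ι → F) → N) :
    ∑ z, ∑ z', f (S.piecewise z z') = Fintype.card (ι → F) * ∑ z, f z := by
  rw [← Fintype.sum_prod_type' (f := fun z z' => f (S.piecewise z z'))]
  refine ((exchangeEquiv S).sum_comp fun z : (ι → F) × (ι → F) => f z.1).trans ?_
  rw [Fintype.sum_prod_type_right]
  simp

theorem piecewise_piecewise_union {ι F : Type*} [DecidableEq ι] (R S : Finset ι) (x z z' : ι → F) :
    R.piecewise x (S.piecewise z z') = (R ∪ S).piecewise (R.piecewise x z) z' := by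
  ext i
  by_cases hR : i ∈ R <;> by_cases hS : i ∈ S <;> simp [hR, hS]

/-- The number of ways to complete the coordinates `x_R` to a vector with answer `α`, where the
discarded coordinates are counted as free. -/
noncomputable def boxCount (a : (ι → F) → A) (α : A) (R : Finset ι) (x : ι → F) : ℝ≥0∞ :=
  ∑ z, if a (R.piecewise x z) = α then 1 else 0

theorem sum_boxCount_union (a : (ι → F) → A) (α : A) (R S : Finset ι) (x : ι → F) :
    ∑ z, boxCount a α (R ∪ S) (R.piecewise x z) =
      Fintype.card (ι → F) * boxCount a α R x := by
  simp only [boxCount, ← piecewise_piecewise_union]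
  exact sum_sum_piecewise S fun z => if a (R.piecewise x z) = α then (1 : ℝ≥0∞) else 0

theorem boxCount_le (a : (ι → F) → A) (α : A) (R : Finset ι) (x : ι → F) :
    boxCount a α R x ≤ Fintype.card (ι → F) := by
  refine (Finset.sum_le_sum (g := fun _ => (1 : ℝ≥0∞)) fun z _ => ?_).trans (by simp)
  split_ifs <;> simp

theorem card_fiber_mul_card [DecidableEq F] (W : ι) (v : F) :
    (∑ z : ι → F, if z W = v then (1 : ℝ≥0∞) else 0) * Fintype.card F =
      Fintype.card (ι → F) := by
  have h : ∀ v' : F, (∑ z : ι → F, if z W = v' then (1 : ℝ≥0∞) else 0) =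
      ∑ z : ι → F, if z W = v then (1 : ℝ≥0∞) else 0 := by
    intro v'
    refine Fintype.sum_equiv (Equiv.piCongrRight fun i => Equiv.swap v v') _ _ fun z => ?_
    simp only [Equiv.piCongrRight_apply, Pi.map_apply]
    congr 1
    rw [Equiv.swap_apply_eq_iff, Equiv.swap_apply_left]
  have h2 : ∑ v' : F, (∑ z : ι → F, if z W = v' then (1 : ℝ≥0∞) else 0) =
      Fintype.card (ι → F) := by
    rw [Finset.sum_comm]
    simp
  rw [← h2, Finset.sum_congr rfl fun v' _ => h v']
  simp [mul_comm]

/-- If the answer determines the coordinate `W` on a box, then revealing this coordinate improves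
the bound on the number of points with a given answer by a factor `|F|`. -/
theorem boxCount_mul_le_of_determined [Nonempty F] (a : (ι → F) → A) (α : A) (R : Finset ι)
    (x : ι → F) (W : ι) (hW : W ∉ R)
    (hdec : ∀ y y' : ι → F, (∀ i ∈ R, y i = x i) → (∀ i ∈ R, y' i = x i) → a y = α → a y' = α →
      y W = y' W) (g : ℕ)
    (hg : ∀ y, boxCount a α (R ∪ {W}) y * (Fintype.card F : ℝ≥0∞) ^ g ≤ Fintype.card (ι → F)) :
    boxCount a α R x * (Fintype.card F : ℝ≥0∞) ^ (g + 1) ≤ Fintype.card (ι → F) := by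
  classical
  by_cases h : ∃ y, (∀ i ∈ R, y i = x i) ∧ a y = α
  · obtain ⟨y, hy, hya⟩ := h
    have hD : (Fintype.card (ι → F) : ℝ≥0∞) ≠ 0 := by simp
    -- The point `y` has answer `α`, so every point of the box with that answer has `W`-coordinate
    -- `y W`; the boxes with another `W`-coordinate contribute nothing.
    have key : ∀ z, boxCount a α (R ∪ {W}) (R.piecewise x z) * (Fintype.card F : ℝ≥0∞) ^ g ≤
        (if z W = y W then 1 else 0) * Fintype.card (ι → F) := by
      intro z
      split_ifs with hz
      · simpa using hg _
      · have : boxCount a α (R ∪ {W}) (R.piecewise x z) = 0 := by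
          refine Finset.sum_eq_zero fun z' _ => if_neg fun hz' => hz ?_
          have := hdec _ y (fun i hi => ?_) hy hz' hya
          · simpa [hW] using this
          · simp [hi]
        rw [this, zero_mul, zero_mul]
    have := Finset.sum_le_sum fun z (_ : z ∈ Finset.univ) => key z
    rw [← Finset.sum_mul, ← Finset.sum_mul, sum_boxCount_union] at this
    rw [← ENNReal.mul_le_mul_iff_right hD (ENNReal.natCast_ne_top _)]
    calc (Fintype.card (ι → F) : ℝ≥0∞) * (boxCount a α R x * (Fintype.card F : ℝ≥0∞) ^ (g + 1))
        = (Fintype.card (ι → F) * boxCount a α R x * (Fintype.card F : ℝ≥0∞) ^ g) *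
            Fintype.card F := by ring
      _ ≤ _ := mul_le_mul_left this _
      _ = (∑ z : ι → F, if z W = y W then (1 : ℝ≥0∞) else 0) * Fintype.card F *
            Fintype.card (ι → F) := by ring
      _ = _ := by rw [card_fiber_mul_card]
  · have : boxCount a α R x = 0 := by
      refine Finset.sum_eq_zero fun z _ => if_neg fun hz => h ⟨_, fun i hi => ?_, hz⟩
      simp [hi]
    simp [this]

/-- A function on `F ^ ι` such that every coordinate `W` can be recovered from the value of the
function and from at most `M` further coordinates `S`, where `S` is drawn with weights `w W S`
that depend only on the coordinates in `S` and have a constant sum: on a box with fixed coordinates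
`R`, no value is taken with probability above `|F| ^ (-g)`, where
`g = ⌈(|ι| - |R|) / (M + 1)⌉`. -/
theorem boxCount_mul_pow_le [Nonempty F] (a : (ι → F) → A) (α : A) (M : ℕ)
    (w : ι → Finset ι → (ι → F) → ℝ≥0∞) (c : ι → ℝ≥0∞)
    (hsupp : ∀ W S x, w W S x ≠ 0 → W ∉ S ∧ S.card ≤ M)
    (hloc : ∀ W S x y, (∀ i ∈ S, x i = y i) → w W S x = w W S y)
    (hsum : ∀ W x, ∑ S, w W S x = c W) (hc0 : ∀ W, c W ≠ 0) (hct : ∀ W, c W ≠ ⊤)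
    (hdec : ∀ W S x y, w W S x ≠ 0 → (∀ i ∈ S, x i = y i) → a x = a y → x W = y W) :
    ∀ (g : ℕ) (R : Finset ι) (x : ι → F),
      g * (M + 1) + R.card < Fintype.card ι + (M + 1) →
      boxCount a α R x * (Fintype.card F : ℝ≥0∞) ^ g ≤ Fintype.card (ι → F) := by
  intro g
  induction g with
  | zero => intro R x _; simpa using boxCount_le a α R x
  | succ g ih =>
    intro R x hR
    have hlt : R.card < Fintype.card ι := by nlinarith
    obtain ⟨W, hW⟩ : ∃ W, W ∉ R := by
      by_contra! h
      rw [Finset.eq_univ_of_forall h, Finset.card_univ] at hlt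
      exact lt_irrefl _ hlt
    -- Where `S` has positive weight, fixing the coordinates in `S` lets the answer determine
    -- coordinate `W`. The set `R ∪ S ∪ {W}` exceeds `R` by at most `M + 1` elements, which is what
    -- one induction step may spend.
    have key : ∀ S y, w W S y * (boxCount a α (R ∪ S) y * (Fintype.card F : ℝ≥0∞) ^ (g + 1)) ≤
        w W S y * Fintype.card (ι → F) := by
      intro S y
      by_cases h0 : w W S y = 0
      · simp [h0]
      obtain ⟨hWS, hS⟩ := hsupp W S y h0
      refine mul_le_mul_right (boxCount_mul_le_of_determined a α (R ∪ S) y W (by simp [hW, hWS])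
        ?_ g fun y => ih _ _ ?_) _
      · intro y₁ y₂ h₁ h₂ e₁ e₂
        refine hdec W S y₁ y₂ ?_ (fun i hi => ?_) (e₁.trans e₂.symm)
        · rwa [hloc W S y₁ y fun i hi => h₁ i (by simp [hi])]
        · rw [h₁ i (by simp [hi]), h₂ i (by simp [hi])]
      · have h1 := Finset.card_union_le (R ∪ S) {W}
        have h2 := Finset.card_union_le R S
        rw [Finset.card_singleton] at h1
        rw [add_mul] at hR
        omega
    have hD : (Fintype.card (ι → F) : ℝ≥0∞) ≠ 0 := by simp
    -- The weight sees only the coordinates in `S`, so it moves inside the count and the two sums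
    -- recombine. Only afterwards can the constant sum over `S` be used.
    have hsum' : ∀ S, ∑ z, w W S (R.piecewise x z) * boxCount a α (R ∪ S) (R.piecewise x z) =
        Fintype.card (ι → F) * ∑ z, w W S (R.piecewise x z) *
          (if a (R.piecewise x z) = α then 1 else 0) := by
      intro S
      rw [← sum_sum_piecewise S]
      refine Finset.sum_congr rfl fun z _ => ?_
      rw [boxCount, Finset.mul_sum]
      refine Finset.sum_congr rfl fun z' _ => ?_
      rw [piecewise_piecewise_union, hloc W S (R.piecewise x z)]
      intro i hi
      simp [hi]
    have h1 : ∑ S, ∑ z, w W S (R.piecewise x z) * boxCount a α (R ∪ S) (R.piecewise x z) =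
        Fintype.card (ι → F) * (c W * boxCount a α R x) := by
      rw [Finset.sum_congr rfl fun S _ => hsum' S, ← Finset.mul_sum, Finset.sum_comm]
      congr 1
      rw [boxCount, Finset.mul_sum]
      refine Finset.sum_congr rfl fun z _ => ?_
      rw [← Finset.sum_mul, hsum]
    have h2 := Finset.sum_le_sum fun S (_ : S ∈ Finset.univ) =>
      Finset.sum_le_sum fun z (_ : z ∈ Finset.univ) => key S (R.piecewise x z)
    simp only [← mul_assoc, ← Finset.sum_mul] at h2
    rw [h1, Finset.sum_comm, Finset.sum_congr rfl fun z _ => hsum W _, Finset.sum_const,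
      Finset.card_univ, nsmul_eq_mul] at h2
    rw [← ENNReal.mul_le_mul_iff_right (mul_ne_zero hD (hc0 W))
      (ENNReal.mul_ne_top (ENNReal.natCast_ne_top _) (hct W))]
    calc _ = _ := by ring
      _ ≤ _ := h2

end Counting

end PIRSI

namespace PIRSI

/-! ### Entropy, conditional entropy and mutual information of discrete laws -/

section Information

theorem ofReal_negMulLog_ge {r : ℝ} (p : ℝ≥0∞) (hp : p ≤ ENNReal.ofReal ((2 : ℝ) ^ (-r))) :
    p * ENNReal.ofReal r ≤ ENNReal.ofReal (Real.negMulLog p.toReal / Real.log 2) := by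
  have hpt : p ≠ ⊤ := ne_top_of_le_ne_top ENNReal.ofReal_ne_top hp
  rcases eq_or_ne p 0 with rfl | h0
  · simp
  have hpos : 0 < p.toReal := ENNReal.toReal_pos h0 hpt
  have hl : p.toReal ≤ (2 : ℝ) ^ (-r) := ENNReal.toReal_le_of_le_ofReal (by positivity) hp
  have hlog : Real.log p.toReal ≤ -r * Real.log 2 := by
    rw [← Real.log_rpow two_pos]
    exact Real.log_le_log hpos hl
  conv_lhs => rw [← ENNReal.ofReal_toReal hpt]
  rw [← ENNReal.ofReal_mul hpos.le]
  apply ENNReal.ofReal_le_ofReal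
  rw [le_div_iff₀ (Real.log_pos one_lt_two), Real.negMulLog]
  nlinarith

/-- Shannon entropy is at least min-entropy. -/
theorem le_entropy {α : Type*} (p : PMF α) {r : ℝ}
    (hp : ∀ a, p a ≤ ENNReal.ofReal ((2 : ℝ) ^ (-r))) : ENNReal.ofReal r ≤ entropy p := by
  calc ENNReal.ofReal r = ∑' a, p a * ENNReal.ofReal r := by
        rw [ENNReal.tsum_mul_right, p.tsum_coe, one_mul]
    _ ≤ entropy p := ENNReal.tsum_le_tsum fun a => ofReal_negMulLog_ge _ (hp a)

/-- This is `log u ≤ u - 1` at `u = 1 / (x n)`. The correction `1 / n - x` sums to zero over a law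
on `n` points, which gives the uniform bound on entropy. -/
theorem negMulLog_le {x n : ℝ} (hx : 0 ≤ x) (hn : 0 < n) :
    Real.negMulLog x ≤ x * Real.log n + (1 / n - x) := by
  rcases hx.eq_or_lt with rfl | hx
  · simp [hn.le]
  have h := Real.log_le_sub_one_of_pos (show 0 < 1 / (x * n) by positivity)
  rw [one_div, Real.log_inv, Real.log_mul hx.ne' hn.ne'] at h
  have h2 : x * (x * n)⁻¹ = 1 / n := by field_simp
  rw [Real.negMulLog]
  nlinarith [mul_le_mul_of_nonneg_left h hx.le]

theorem entropy_le_log_card {α : Type*} [Fintype α] [Nonempty α] (p : PMF α) :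
    entropy p ≤ ENNReal.ofReal (Real.logb 2 (Fintype.card α)) := by
  have hn : (0 : ℝ) < Fintype.card α := by exact_mod_cast Fintype.card_pos
  have hp1 : ∑ a, (p a).toReal = 1 := by
    rw [← ENNReal.toReal_sum fun a _ => p.apply_ne_top a, ← tsum_fintype (L := .unconditional _),
      p.tsum_coe, ENNReal.toReal_one]
  rw [entropy, tsum_fintype, ← ENNReal.ofReal_sum_of_nonneg]
  · apply ENNReal.ofReal_le_ofReal
    rw [← Finset.sum_div, Real.logb]
    gcongr
    refine (Finset.sum_le_sum fun a _ => negMulLog_le (p a).toReal_nonneg hn).trans ?_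
    rw [Finset.sum_add_distrib, Finset.sum_sub_distrib, ← Finset.sum_mul, hp1]
    simp [hn.ne']
  · intro a _
    exact div_nonneg (Real.negMulLog_nonneg ENNReal.toReal_nonneg
      (ENNReal.toReal_le_of_le_ofReal zero_le_one (by simpa using p.coe_le_one a)))
      (Real.log_pos one_lt_two).le

theorem map_snd_apply {α β : Type*} (p : PMF (α × β)) (b : β) :
    p.map Prod.snd b = ∑' a, p (a, b) := by
  classical
  rw [PMF.map_apply, ENNReal.tsum_prod']
  refine tsum_congr fun a => ?_
  rw [tsum_eq_single b fun b' hb' => if_neg hb'.symm, if_pos rfl]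

/-- `H(U | V) = 0` means that `V` determines `U`. -/
theorem condEntropy_eq_zero_iff {α β : Type*} (p : PMF (α × β)) :
    condEntropy p = 0 ↔ ∀ u u' v, (u, v) ∈ p.support → (u', v) ∈ p.support → u = u' := by
  classical
  rw [condEntropy, ENNReal.tsum_eq_zero]
  constructor
  · intro h u u' v hu hu'
    by_contra hne
    have hlt : p (u, v) < p.map Prod.snd v := by
      rw [map_snd_apply]
      calc p (u, v) < p (u, v) + p (u', v) :=
            ENNReal.lt_add_right (p.apply_ne_top _) ((p.mem_support_iff _).1 hu')
        _ = ∑ a ∈ {u, u'}, p (a, v) := (Finset.sum_pair (f := fun a => p (a, v)) hne).symm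
        _ ≤ _ := ENNReal.sum_le_tsum _
    have h1 : 0 < (p (u, v)).toReal :=
      ENNReal.toReal_pos ((p.mem_support_iff _).1 hu) (p.apply_ne_top _)
    have h2 : (p (u, v)).toReal < (p.map Prod.snd v).toReal :=
      (ENNReal.toReal_lt_toReal (p.apply_ne_top _) (PMF.apply_ne_top _ _)).2 hlt
    have h3 := h (u, v)
    rw [ENNReal.ofReal_eq_zero] at h3
    exact absurd h3 (not_le.2 (mul_pos h1 (Real.logb_pos one_lt_two ((one_lt_div h1).2 h2))))
  · rintro h ⟨u, v⟩
    by_cases hu : p (u, v) = 0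
    · simp [hu]
    have : p.map Prod.snd v = p (u, v) := by
      rw [map_snd_apply, tsum_eq_single u]
      intro u' hne
      by_contra hu'
      exact hne (h u' u v ((p.mem_support_iff _).2 hu') ((p.mem_support_iff _).2 hu))
    have h1 : (p (u, v)).toReal ≠ 0 := (ENNReal.toReal_pos hu (p.apply_ne_top _)).ne'
    simp [this, div_self h1]

/-- Zero conditional entropy of a pair of functions of a random variable. -/
theorem condEntropy_map_eq_zero_iff {Ω α β : Type*} (μ : PMF Ω) (f : Ω → α) (k : Ω → β) :
    condEntropy (μ.map fun z => (f z, k z)) = 0 ↔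
      ∀ z ∈ μ.support, ∀ z' ∈ μ.support, k z = k z' → f z = f z' := by
  rw [condEntropy_eq_zero_iff]
  simp only [PMF.mem_support_map_iff, Prod.mk.injEq]
  constructor
  · intro h z hz z' hz' hk
    exact h _ _ (k z) ⟨z, hz, rfl, rfl⟩ ⟨z', hz', rfl, hk.symm⟩
  · rintro h u u' v ⟨z, hz, rfl, rfl⟩ ⟨z', hz', rfl, hk⟩
    exact h z hz z' hz' hk.symm

theorem apply_eq_mul_of_mutualInfo_eq_zero {α β : Type*} (p : PMF (α × β))
    (h : mutualInfo p = 0) (a : α) (b : β) :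
    p (a, b) = p.map Prod.fst a * p.map Prod.snd b := by
  let _ : MeasurableSpace α := ⊤
  let _ : MeasurableSpace β := ⊤
  have h1 : p.toMeasure = (p.map Prod.fst).toMeasure.prod (p.map Prod.snd).toMeasure :=
    InformationTheory.klDiv_eq_zero_iff.1 h
  have hs : ({(a, b)} : Set (α × β)) = {a} ×ˢ {b} := by simp
  have hm : MeasurableSet ({(a, b)} : Set (α × β)) := by
    rw [hs]
    exact MeasurableSet.prod trivial trivial
  rw [← p.toMeasure_apply_singleton _ hm, h1, hs, MeasureTheory.Measure.prod_prod,
    PMF.toMeasure_apply_singleton _ _ (measurableSet_singleton a),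
    PMF.toMeasure_apply_singleton _ _ (measurableSet_singleton b)]

/-- Summing over `a` shows that `k` must be the second marginal. Countability lets the values at
singletons determine the measures. -/
theorem mutualInfo_eq_zero_of_apply_eq_mul {α β : Type*} [Countable α] [Countable β]
    (p : PMF (α × β)) (k : β → ℝ≥0∞) (h : ∀ a b, p (a, b) = p.map Prod.fst a * k b) :
    mutualInfo p = 0 := by
  have hk : ∀ b, p.map Prod.snd b = k b := by
    intro b
    rw [map_snd_apply, tsum_congr fun a => h a b, ENNReal.tsum_mul_right, PMF.tsum_coe, one_mul]
  let _ : MeasurableSpace α := ⊤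
  let _ : MeasurableSpace β := ⊤
  refine InformationTheory.klDiv_eq_zero_iff.2 (MeasureTheory.Measure.ext_of_singleton ?_)
  rintro ⟨a, b⟩
  have hs : ({(a, b)} : Set (α × β)) = {a} ×ˢ {b} := by simp
  have hm : MeasurableSet ({(a, b)} : Set (α × β)) := by
    rw [hs]
    exact MeasurableSet.prod trivial trivial
  rw [PMF.toMeasure_apply_singleton _ _ hm, hs, MeasureTheory.Measure.prod_prod,
    PMF.toMeasure_apply_singleton _ _ (measurableSet_singleton a),
    PMF.toMeasure_apply_singleton _ _ (measurableSet_singleton b), hk, h]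

end Information

/-! ### Decodability and privacy as statements about query weights -/

namespace Scheme

variable {K t : ℕ} (σ : Scheme K t)

theorem queryLaw_apply (W : Fin K) (S : Finset (Fin K)) (q : σ.Query) (x : Database K t) :
    σ.queryLaw W S (q, x) =
      (Fintype.card (Database K t) : ℝ≥0∞)⁻¹ * σ.query W S (sideInfo S x) q := by
  classical
  rw [queryLaw, PMF.bind_apply, tsum_eq_single x]
  · rw [databaseLaw, PMF.uniformOfFintype_apply, PMF.map_apply, tsum_eq_single q]
    · simp
    · intro q' hq'
      simp [hq'.symm]
  · intro x' hx'
    rw [PMF.map_apply]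
    simp [hx'.symm]

theorem mem_support_queryLaw {W : Fin K} {S : Finset (Fin K)} {q : σ.Query}
    {x : Database K t} :
    (q, x) ∈ (σ.queryLaw W S).support ↔ σ.query W S (sideInfo S x) q ≠ 0 := by
  rw [PMF.mem_support_iff, queryLaw_apply]
  simp [ENNReal.natCast_ne_top]

/-- Positivity is required at `x` alone: the query depends on the database through `X_S`, so a `y`
that agrees with `x` on `S` sends `q` with the same probability. -/
theorem decodableWithQuery_iff (p : PMF (Fin K × Finset (Fin K))) :
    σ.DecodableWithQuery p ↔ ∀ W S, p (W, S) ≠ 0 → ∀ (q : σ.Query) (x y : Database K t),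
      σ.query W S (sideInfo S x) q ≠ 0 → sideInfo S x = sideInfo S y →
      σ.answer q x = σ.answer q y → x W = y W := by
  simp only [DecodableWithQuery, decodingLawWithQuery, condEntropy_map_eq_zero_iff, Prod.forall,
    mem_support_queryLaw, Prod.mk.injEq]
  simp only [PMF.mem_support_iff]
  constructor
  · intro h W S hp q x y hq hxy ha
    exact h W S hp q x hq q y (hxy ▸ hq) ⟨rfl, ha, hxy⟩
  · rintro h W S hp q x hq q' y hq' ⟨rfl, ha, hxy⟩
    exact h W S hp q x y hq hxy ha

theorem decodable_iff (p : PMF (Fin K × Finset (Fin K))) :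
    σ.Decodable p ↔ ∀ W S, p (W, S) ≠ 0 → ∀ (q q' : σ.Query) (x y : Database K t),
      σ.query W S (sideInfo S x) q ≠ 0 → σ.query W S (sideInfo S y) q' ≠ 0 →
      sideInfo S x = sideInfo S y → σ.answer q x = σ.answer q' y → x W = y W := by
  simp only [Decodable, decodingLaw, condEntropy_map_eq_zero_iff, Prod.forall,
    mem_support_queryLaw, Prod.mk.injEq]
  simp only [PMF.mem_support_iff]
  constructor
  · intro h W S hp q q' x y hq hq' hxy ha
    exact h W S hp q x hq q' y hq' ⟨ha, hxy⟩
  · rintro h W S hp q x hq q' y hq' ⟨ha, hxy⟩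
    exact h W S hp q q' x y hq hq' hxy ha

theorem Decodable.decodableWithQuery {σ : Scheme K t} {p : PMF (Fin K × Finset (Fin K))}
    (h : σ.Decodable p) : σ.DecodableWithQuery p := by
  rw [decodableWithQuery_iff]
  intro W S hp q x y hq hxy ha
  exact (σ.decodable_iff p).1 h W S hp q q x y hq (hxy ▸ hq) hxy ha

/-- The probability that the demand index is `W` and the query is `q`, given the database. -/
noncomputable def demandWeight (p : PMF (Fin K × Finset (Fin K))) (W : Fin K) (q : σ.Query)
    (x : Database K t) : ℝ≥0∞ :=
  ∑ S, p (W, S) * σ.query W S (sideInfo S x) q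

open Classical in
theorem serverLaw_apply (p : PMF (Fin K × Finset (Fin K))) (W : Fin K) (q : σ.Query)
    (a : σ.Answer) (x : Database K t) :
    σ.serverLaw p (W, (q, a, x)) =
      if a = σ.answer q x then
        (Fintype.card (Database K t) : ℝ≥0∞)⁻¹ * σ.demandWeight p W q x else 0 := by
  have key : ∀ ws : Fin K × Finset (Fin K),
      ((σ.queryLaw ws.1 ws.2).map fun z => (ws.1, (z.1, σ.answer z.1 z.2, z.2)))
        (W, (q, a, x)) =
      if W = ws.1 ∧ a = σ.answer q x then σ.queryLaw ws.1 ws.2 (q, x) else 0 := by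
    intro ws
    rw [PMF.map_apply, tsum_eq_single (q, x)]
    · simp
    · rintro ⟨q', x'⟩ hne
      refine if_neg fun h => hne ?_
      simp only [Prod.mk.injEq] at h
      simp [h.2.1, h.2.2.2]
  rw [serverLaw, PMF.bind_apply, tsum_fintype, Fintype.sum_prod_type, Finset.sum_eq_single W]
  · rw [Finset.sum_congr rfl fun S _ => congrArg (p (W, S) * ·) (key (W, S))]
    simp only [queryLaw_apply, true_and, demandWeight]
    split_ifs
    · rw [Finset.mul_sum]
      exact Finset.sum_congr rfl fun S _ => by ring
    · simp
  · intro W' _ hne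
    refine Finset.sum_eq_zero fun S _ => ?_
    rw [key (W', S), if_neg fun h => hne h.1.symm, mul_zero]
  · simp

theorem map_fst_serverLaw (p : PMF (Fin K × Finset (Fin K))) :
    (σ.serverLaw p).map Prod.fst = p.map Prod.fst := by
  rw [serverLaw, PMF.map_bind]
  simp only [PMF.map_comp]
  rw [← PMF.bind_pure_comp]
  congr 1
  funext ws
  exact PMF.map_const _ _

theorem wPrivate_of_demandWeight [Countable σ.Query] [Countable σ.Answer]
    (p : PMF (Fin K × Finset (Fin K))) (h : σ.Query → ℝ≥0∞)
    (hw : ∀ W q x, σ.demandWeight p W q x = p.map Prod.fst W * h q) : σ.WPrivate p := by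
  classical
  refine mutualInfo_eq_zero_of_apply_eq_mul _ (fun b => if b.2.1 = σ.answer b.1 b.2.2 then
    (Fintype.card (Database K t) : ℝ≥0∞)⁻¹ * h b.1 else 0) ?_
  rintro W ⟨q, a, x⟩
  rw [serverLaw_apply, map_fst_serverLaw, hw]
  simp only
  split_ifs
  · ring
  · simp

/-- In a `W`-private scheme the query is independent of the pair of the demand index and the
database. -/
theorem WPrivate.exists_demandWeight_eq {σ : Scheme K t} {p : PMF (Fin K × Finset (Fin K))}
    (hσ : σ.WPrivate p) (hpos : ∀ W, 0 < p.map Prod.fst W)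
    (hadm : ∀ ws ∈ p.support, ws.1 ∉ ws.2) (q : σ.Query) :
    ∃ h : ℝ≥0∞, ∀ W x, σ.demandWeight p W q x = p.map Prod.fst W * h := by
  classical
  let D : ℝ≥0∞ := Fintype.card (Database K t)
  have hD0 : D ≠ 0 := by simp [D]
  have hDt : D ≠ ⊤ := ENNReal.natCast_ne_top _
  let f : Database K t → ℝ≥0∞ := fun x =>
    D * (σ.serverLaw p).map Prod.snd (q, σ.answer q x, x)
  have hf : ∀ W x, σ.demandWeight p W q x = p.map Prod.fst W * f x := by
    intro W x
    have h1 := apply_eq_mul_of_mutualInfo_eq_zero _ hσ W (q, σ.answer q x, x)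
    rw [serverLaw_apply, if_pos rfl, map_fst_serverLaw] at h1
    calc σ.demandWeight p W q x = D * (D⁻¹ * σ.demandWeight p W q x) := by
          rw [← mul_assoc, ENNReal.mul_inv_cancel hD0 hDt, one_mul]
      _ = D * (p.map Prod.fst W * (σ.serverLaw p).map Prod.snd (q, σ.answer q x, x)) := by
          rw [← h1]
      _ = _ := by ring
  -- Every possible `S` avoids `W`, so the weight for demand `W` ignores coordinate `W`; since `f`
  -- is the same for all demands, it ignores every coordinate.
  have hupd : ∀ W x v, f (Function.update x W v) = f x := by
    intro W x v
    have h1 : σ.demandWeight p W q (Function.update x W v) = σ.demandWeight p W q x := by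
      refine Finset.sum_congr rfl fun S _ => ?_
      by_cases h0 : p (W, S) = 0
      · simp [h0]
      have hWS : W ∉ S := hadm (W, S) ((p.mem_support_iff _).2 h0)
      have : sideInfo S (Function.update x W v) = sideInfo S x := by
        funext i
        have hi : (i : Fin K) ≠ W := fun h => hWS (h ▸ i.2)
        exact Function.update_of_ne hi _ _
      rw [this]
    rw [hf, hf] at h1
    exact (ENNReal.mul_right_inj (hpos W).ne' (PMF.apply_ne_top _ _)).1 h1
  have hconst : ∀ x y, f x = f y := by
    intro x y
    have : ∀ R : Finset (Fin K), f (R.piecewise x y) = f y := by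
      intro R
      induction R using Finset.induction_on with
      | empty => simp
      | insert i R _ ih => rw [Finset.piecewise_insert, hupd, ih]
    simpa using this Finset.univ
  exact ⟨f 0, fun W x => by rw [hf, hconst x 0]⟩

end Scheme

end PIRSI

namespace PIRSI

theorem card_msg {t : ℕ} (ht : 1 ≤ t) : Fintype.card (Msg t) = 2 ^ t := by
  rw [← Nat.card_eq_fintype_card]
  exact GaloisField.card 2 t (by omega)

namespace Scheme

variable {K t : ℕ} (σ : Scheme K t)

/-! ### Converse: lower bound on the entropy of the answer -/

section Converse

variable {σ} {p : PMF (Fin K × Finset (Fin K))} {M : ℕ}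

open Classical in
-- The user's own side information opens the recursion: on the box fixed by `x_S` the answer
-- determines `x_W`, which gives one factor. The remaining `n` come from `boxCount_mul_pow_le` on `S
-- ∪ {W}`, of size at most `M + 1`.
theorem boxCount_answer_mul_pow_le (hpos : ∀ W, 0 < p.map Prod.fst W)
    (hadm : ∀ ws ∈ p.support, ws.1 ∉ ws.2 ∧ ws.2.card = M)
    (hdec : σ.DecodableWithQuery p) (hpriv : σ.WPrivate p) {W : Fin K} {S : Finset (Fin K)}
    (hp : p (W, S) ≠ 0) {q : σ.Query} {x : Database K t}
    (hq : σ.query W S (sideInfo S x) q ≠ 0) (α : σ.Answer) {n : ℕ} (hn : n * (M + 1) < K) :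
    boxCount (σ.answer q) α S x * (Fintype.card (Msg t) : ℝ≥0∞) ^ (n + 1) ≤
      Fintype.card (Database K t) := by
  rw [decodableWithQuery_iff] at hdec
  obtain ⟨h, hh⟩ := hpriv.exists_demandWeight_eq hpos (fun ws hws => (hadm ws hws).1) q
  have hside : ∀ (S : Finset (Fin K)) (x y : Database K t), (∀ i ∈ S, x i = y i) →
      sideInfo S x = sideInfo S y := fun S x y hxy => funext fun i => hxy i i.2
  have hWS : W ∉ S ∧ S.card = M := hadm (W, S) ((p.mem_support_iff _).2 hp)
  have hd0 : p.map Prod.fst W * h ≠ 0 := by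
    rw [← hh W x, demandWeight]
    intro h0
    rw [Finset.sum_eq_zero_iff] at h0
    exact mul_ne_zero hp hq (h0 S (Finset.mem_univ _))
  have hdt : ∀ W x, σ.demandWeight p W q x ≠ ⊤ := fun W x =>
    ENNReal.sum_ne_top.2 fun S _ => ENNReal.mul_ne_top (p.apply_ne_top _) (PMF.apply_ne_top _ _)
  refine boxCount_mul_le_of_determined _ _ _ _ W hWS.1 ?_ n fun y =>
    boxCount_mul_pow_le (σ.answer q) α M
      (fun W S x => p (W, S) * σ.query W S (sideInfo S x) q) (fun W => p.map Prod.fst W * h)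
      ?_ ?_ hh ?_ ?_ ?_ n _ y ?_
  · intro y y' hy hy' e e'
    refine hdec W S hp q y y' ?_ (hside S _ _ fun i hi => ?_) (e.trans e'.symm)
    · rwa [hside S y x hy]
    · rw [hy i hi, hy' i hi]
  · intro W S x h0
    have := hadm (W, S) ((p.mem_support_iff _).2 (left_ne_zero_of_mul h0))
    exact ⟨this.1, this.2.le⟩
  · intro W S x y hxy
    simp only [hside S x y hxy]
  · exact fun W' => mul_ne_zero (hpos W').ne' (right_ne_zero_of_mul hd0)
  · exact fun W' => hh W' x ▸ hdt W' x
  · intro W S x y h0 hxy ha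
    exact hdec W S (left_ne_zero_of_mul h0) q x y (right_ne_zero_of_mul h0) (hside S x y hxy) ha
  · have h1 := Finset.card_union_le S {W}
    rw [Finset.card_singleton, hWS.2] at h1
    rw [Fintype.card_fin]
    omega

theorem answerLaw_mul_pow_le (hpos : ∀ W, 0 < p.map Prod.fst W)
    (hadm : ∀ ws ∈ p.support, ws.1 ∉ ws.2 ∧ ws.2.card = M)
    (hdec : σ.DecodableWithQuery p) (hpriv : σ.WPrivate p) {W : Fin K} {S : Finset (Fin K)}
    (hp : p (W, S) ≠ 0) (α : σ.Answer) {n : ℕ} (hn : n * (M + 1) < K) :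
    σ.answerLaw W S α * (Fintype.card (Msg t) : ℝ≥0∞) ^ (n + 1) ≤ 1 := by
  classical
  have hD0 : (Fintype.card (Database K t) : ℝ≥0∞) ≠ 0 := by simp
  have hDt : (Fintype.card (Database K t) : ℝ≥0∞) ≠ ⊤ := ENNReal.natCast_ne_top _
  have key : ∀ q, (∑ x : Database K t, σ.query W S (sideInfo S x) q *
      (if σ.answer q x = α then 1 else 0)) * (Fintype.card (Msg t) : ℝ≥0∞) ^ (n + 1) ≤
      ∑ x : Database K t, σ.query W S (sideInfo S x) q := by
    intro q
    -- The extra factor splits the database into its `S`-part, which fixes the query's probability,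
    -- and a free remainder, on which the box bound applies.
    rw [← ENNReal.mul_le_mul_iff_right hD0 hDt, ← mul_assoc, ← sum_sum_piecewise S,
      Finset.sum_mul, Finset.mul_sum]
    refine Finset.sum_le_sum fun z _ => ?_
    have hz : ∀ z', sideInfo S (S.piecewise z z') = sideInfo S z := fun z' =>
      funext fun i => S.piecewise_eq_of_mem _ _ i.2
    simp only [hz, ← Finset.mul_sum]
    by_cases hq : σ.query W S (sideInfo S z) q = 0
    · simp [hq]
    rw [mul_assoc, mul_comm (Fintype.card (Database K t) : ℝ≥0∞)]
    exact mul_le_mul_right (boxCount_answer_mul_pow_le hpos hadm hdec hpriv hp hq α hn) _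
  have h1 : σ.answerLaw W S α = ∑' q, (Fintype.card (Database K t) : ℝ≥0∞)⁻¹ *
      ∑ x : Database K t, σ.query W S (sideInfo S x) q *
        (if σ.answer q x = α then 1 else 0) := by
    rw [answerLaw, PMF.map_apply, ENNReal.tsum_prod']
    refine tsum_congr fun q => ?_
    rw [tsum_fintype, Finset.mul_sum]
    refine Finset.sum_congr rfl fun x _ => ?_
    simp only [queryLaw_apply, eq_comm (a := α)]
    split_ifs <;> simp
  calc σ.answerLaw W S α * (Fintype.card (Msg t) : ℝ≥0∞) ^ (n + 1)
      = ∑' q, (Fintype.card (Database K t) : ℝ≥0∞)⁻¹ *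
        ((∑ x : Database K t, σ.query W S (sideInfo S x) q *
          (if σ.answer q x = α then 1 else 0)) *
            (Fintype.card (Msg t) : ℝ≥0∞) ^ (n + 1)) := by
        rw [h1, ← ENNReal.tsum_mul_right]
        exact tsum_congr fun q => mul_assoc _ _ _
    _ ≤ ∑' q, (Fintype.card (Database K t) : ℝ≥0∞)⁻¹ *
          ∑ x : Database K t, σ.query W S (sideInfo S x) q :=
        ENNReal.tsum_le_tsum fun q => mul_le_mul_right (key q) _
    _ = 1 := by
        rw [ENNReal.tsum_mul_left, Summable.tsum_finsetSum fun _ _ => ENNReal.summable]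
        simp only [PMF.tsum_coe, Finset.sum_const, Finset.card_univ, nsmul_eq_mul, mul_one]
        exact ENNReal.inv_mul_cancel hD0 hDt

/-- The answer of a private scheme has at least `⌈K / (M + 1)⌉ t` bits of entropy. -/
theorem le_entropy_answerLaw (ht : 1 ≤ t) (hpos : ∀ W, 0 < p.map Prod.fst W)
    (hadm : ∀ ws ∈ p.support, ws.1 ∉ ws.2 ∧ ws.2.card = M)
    (hdec : σ.DecodableWithQuery p) (hpriv : σ.WPrivate p) {W : Fin K} {S : Finset (Fin K)}
    (hp : p (W, S) ≠ 0) {n : ℕ} (hn : n * (M + 1) < K) :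
    ((n + 1 : ℕ) : ℝ≥0∞) * t ≤ entropy (σ.answerLaw W S) := by
  have h := le_entropy (σ.answerLaw W S) (r := ((n + 1 : ℕ) * t : ℝ)) fun α => ?_
  · rwa [ENNReal.ofReal_mul (by positivity), ENNReal.ofReal_natCast, ENNReal.ofReal_natCast] at h
  have h1 := answerLaw_mul_pow_le hpos hadm hdec hpriv hp α hn
  have h2 : ENNReal.ofReal ((2 : ℝ) ^ (-(((n + 1 : ℕ) : ℝ) * t))) =
      ((Fintype.card (Msg t) : ℝ≥0∞) ^ (n + 1))⁻¹ := by
    rw [Real.rpow_neg two_pos.le, ENNReal.ofReal_inv_of_pos (by positivity), card_msg ht,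
      ← Nat.cast_mul, Real.rpow_natCast, ENNReal.ofReal_pow two_pos.le]
    simp [← pow_mul, mul_comm]
  rw [h2]
  exact ENNReal.le_inv_iff_mul_le.2 h1

end Converse

end Scheme

theorem exists_ceil_eq_succ {K M : ℕ} (h : M < K) :
    ∃ n : ℕ, ⌈(K : ℝ) / ((M : ℝ) + 1)⌉₊ = n + 1 ∧ n * (M + 1) < K ∧ K ≤ (n + 1) * (M + 1) := by
  have hM : (0 : ℝ) < (M : ℝ) + 1 := by positivity
  have hK : (0 : ℝ) < K := by exact_mod_cast (by omega : 0 < K)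
  obtain ⟨n, hn⟩ := Nat.exists_eq_succ_of_ne_zero (Nat.ceil_pos.2 (div_pos hK hM)).ne'
  refine ⟨n, hn, ?_, ?_⟩
  · have h1 : n < ⌈(K : ℝ) / ((M : ℝ) + 1)⌉₊ := by omega
    rw [Nat.lt_ceil, lt_div_iff₀ hM] at h1
    exact_mod_cast h1
  · have h1 := Nat.le_ceil ((K : ℝ) / ((M : ℝ) + 1))
    rw [hn, div_le_iff₀ hM] at h1
    exact_mod_cast h1

theorem rateAt_le {K M t : ℕ} (hMK : M < K) {p : PMF (Fin K × Finset (Fin K))}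
    (hpos : ∀ W, 0 < p.map Prod.fst W) (hadm : ∀ ws ∈ p.support, ws.1 ∉ ws.2 ∧ ws.2.card = M)
    (ht : 1 ≤ t) {σ : Scheme K t} (hdec : σ.DecodableWithQuery p) (hpriv : σ.WPrivate p)
    {ws : Fin K × Finset (Fin K)} (hws : ws ∈ p.support) :
    σ.rateAt ws.1 ws.2 ≤ ((⌈(K : ℝ) / ((M : ℝ) + 1)⌉₊ : ℕ) : ℝ≥0∞)⁻¹ := by
  obtain ⟨n, hn, hlt, -⟩ := exists_ceil_eq_succ hMK
  have ht0 : (t : ℝ≥0∞) ≠ 0 := by exact_mod_cast (by omega : t ≠ 0)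
  rw [hn, Scheme.rateAt]
  refine (ENNReal.div_le_div_left
    (Scheme.le_entropy_answerLaw ht hpos hadm hdec hpriv ((p.mem_support_iff _).1 hws) hlt)
      _).trans ?_
  rw [ENNReal.div_eq_inv_mul, ENNReal.mul_inv (by simp) (by simp), mul_assoc,
    ENNReal.inv_mul_cancel ht0 (ENNReal.natCast_ne_top _), mul_one]

end PIRSI

namespace PIRSI

/-! ### Permutations compatible with a demand and its side information -/

theorem map_fst_apply {α β : Type*} (p : PMF (α × β)) (a : α) :
    p.map Prod.fst a = ∑' b, p (a, b) := by
  classical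
  rw [PMF.map_apply, ENNReal.tsum_prod', tsum_eq_single a fun a' ha' => by simp [ha'.symm]]
  simp

theorem mem_support_uniformPairLaw {K M : ℕ} (h : M < K) {ws : Fin K × Finset (Fin K)} :
    ws ∈ (uniformPairLaw K M h).support ↔ ws.1 ∉ ws.2 ∧ ws.2.card = M := by
  rw [uniformPairLaw, PMF.mem_support_uniformOfFinset_iff]
  simp [admissiblePairs]

section Permutations

variable {K : ℕ}

theorem exists_perm_of_card_eq {W W' : Fin K} {S S' : Finset (Fin K)} (hW : W ∉ S)
    (hW' : W' ∉ S') (hS : S.card = S'.card) :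
    ∃ τ : Equiv.Perm (Fin K), τ W = W' ∧ S.image τ = S' := by
  let e : {i // i ∈ S} ≃ {i // i ∈ S'} := Finset.equivOfCardEq hS
  let τ := e.extendSubtype
  have hτ : ∀ i ∈ S, τ i ∈ S' := fun i hi => e.extendSubtype_mem i hi
  have hτW : τ W ∉ S' := e.extendSubtype_not_mem W hW
  -- The swap corrects the image of `W` without disturbing `S'`, since both swapped points lie
  -- outside it.
  refine ⟨τ.trans (Equiv.swap (τ W) W'), by simp, ?_⟩
  refine Finset.eq_of_subset_of_card_le (fun j hj => ?_) ?_
  · obtain ⟨i, hi, rfl⟩ := Finset.mem_image.1 hj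
    have h := hτ i hi
    rw [Equiv.trans_apply, Equiv.swap_apply_of_ne_of_ne (ne_of_mem_of_not_mem h hτW)
      (ne_of_mem_of_not_mem h hW')]
    exact h
  · rw [Finset.card_image_of_injective _ (Equiv.injective _), hS]

/-- The arrangements of the indices which send the side information onto the set `B` prescribed by
the position of the demand. -/
def compatible (B : Fin K → Finset (Fin K)) (W : Fin K) (S : Finset (Fin K)) :
    Finset (Equiv.Perm (Fin K)) :=
  Finset.univ.filter fun π => S.image π = B (π W)

variable {B : Fin K → Finset (Fin K)} {M : ℕ}

theorem mem_compatible {W : Fin K} {S : Finset (Fin K)} {π : Equiv.Perm (Fin K)} :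
    π ∈ compatible B W S ↔ S.image π = B (π W) := by
  simp [compatible]

theorem compatible_nonempty (hB : ∀ u, u ∉ B u ∧ (B u).card = M) {W : Fin K}
    {S : Finset (Fin K)} (hW : W ∉ S) (hS : S.card = M) :
    (compatible B W S).Nonempty := by
  obtain ⟨π, h1, h2⟩ := exists_perm_of_card_eq hW (hB W).1 (hS.trans (hB W).2.symm)
  exact ⟨π, mem_compatible.2 (by rw [h1, h2])⟩

/-- Precomposition with a permutation carrying `(W', S')` to `(W, S)` injects one set of
arrangements into the other. -/
theorem card_compatible_le {W W' : Fin K} {S S' : Finset (Fin K)} (hW : W ∉ S) (hW' : W' ∉ S')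
    (hS : S.card = S'.card) : (compatible B W S).card ≤ (compatible B W' S').card := by
  obtain ⟨τ, h1, h2⟩ := exists_perm_of_card_eq hW' hW hS.symm
  refine Finset.card_le_card_of_injOn (fun π => τ.trans π) (fun π hπ => ?_) fun π _ π' _ h => ?_
  · have hπ : S.image π = B (π W) := mem_compatible.1 hπ
    refine mem_compatible.2 ?_
    rw [Equiv.coe_trans, ← Finset.image_image, h2, Function.comp_apply, h1, hπ]
  · ext i
    have := congrArg (fun ρ : Equiv.Perm (Fin K) => ρ (τ.symm i)) h
    simpa using congrArg Fin.val this

theorem card_compatible_eq {W W' : Fin K} {S S' : Finset (Fin K)} (hW : W ∉ S) (hW' : W' ∉ S')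
    (hS : S.card = S'.card) : (compatible B W S).card = (compatible B W' S').card :=
  (card_compatible_le hW hW' hS).antisymm (card_compatible_le hW' hW hS.symm)

/-- The positions `0, …, K - 1` are cut into consecutive blocks of length `M + 1`, the last one
possibly shorter; `B u` is a set of `M` positions that together with `u` covers its block. -/
theorem exists_cover_blocks {K M n : ℕ} (hMK : M < K) (hK : K ≤ n * (M + 1)) :
    ∃ (block : Fin K → Fin n) (B : Fin K → Finset (Fin K)),
      (∀ u, u ∉ B u ∧ (B u).card = M) ∧ ∀ u j, j ≠ u → block j = block u → j ∈ B u := by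
  let block : Fin K → Fin n := fun i => ⟨i / (M + 1),
    (Nat.div_lt_iff_lt_mul (Nat.succ_pos M)).2 (i.2.trans_le hK)⟩
  have hcard : ∀ u, ((Finset.univ.filter fun j => block j = block u).erase u).card ≤ M := by
    intro u
    rw [Finset.card_erase_of_mem (by simp)]
    have : (Finset.univ.filter fun j => block j = block u).card ≤ (Finset.range (M + 1)).card := by
      refine Finset.card_le_card_of_injOn (fun j => (j : ℕ) % (M + 1))
        (fun j _ => by simpa using Nat.mod_lt j (Nat.succ_pos M)) fun i hi j hj h => ?_
      have hi : (i : ℕ) / (M + 1) = (u : ℕ) / (M + 1) := by simpa [block] using hi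
      have hj : (j : ℕ) / (M + 1) = (u : ℕ) / (M + 1) := by simpa [block] using hj
      have h : (i : ℕ) % (M + 1) = (j : ℕ) % (M + 1) := h
      ext
      rw [← Nat.div_add_mod (i : ℕ) (M + 1), ← Nat.div_add_mod (j : ℕ) (M + 1), hi, hj, h]
    rw [Finset.card_range] at this
    omega
  -- A short last block leaves fewer than `M` companions, so the set is padded with arbitrary
  -- positions other than `u`; `M < K` leaves enough of them.
  have hex : ∀ u : Fin K, ∃ T : Finset (Fin K),
      ((Finset.univ.filter fun j => block j = block u).erase u) ⊆ T ∧
        T ⊆ Finset.univ.erase u ∧ T.card = M := by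
    intro u
    refine Finset.exists_subsuperset_card_eq (Finset.erase_subset_erase _ (Finset.subset_univ _))
      (hcard u) ?_
    rw [Finset.card_erase_of_mem (Finset.mem_univ _), Finset.card_fin]
    omega
  choose B h1 h2 h3 using hex
  refine ⟨block, B, fun u => ⟨fun hu => by simpa using h2 u hu, h3 u⟩, fun u j hj hb => h1 u ?_⟩
  simp [hj, hb]

end Permutations

/-! ### The partition and code scheme: decodability and privacy -/

/-- A uniformly random compatible arrangement. -/
noncomputable def partitionQuery {K : ℕ} (B : Fin K → Finset (Fin K)) (W : Fin K)
    (S : Finset (Fin K)) : PMF (Equiv.Perm (Fin K)) :=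
  if h : (compatible B W S).Nonempty then PMF.uniformOfFinset _ h else PMF.pure 1

/-- Partition and code: the query arranges the messages in blocks, and the answer consists of the
sum of the messages in each block. -/
noncomputable def partitionScheme {K n : ℕ} (block : Fin K → Fin n)
    (B : Fin K → Finset (Fin K)) (t : ℕ) : Scheme K t where
  Query := Equiv.Perm (Fin K)
  Answer := Fin n → Msg t
  query W S _ := partitionQuery B W S
  answer π x b := ∑ j with block (π j) = b, x j

/-- The scheme in which the server repeats the query in its answer. -/
def Scheme.echo {K t : ℕ} (σ : Scheme K t) : Scheme K t where
  Query := σ.Query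
  Answer := σ.Query × σ.Answer
  query := σ.query
  answer q x := (q, σ.answer q x)

theorem Scheme.decodable_echo {K t : ℕ} {σ : Scheme K t} {p : PMF (Fin K × Finset (Fin K))}
    (h : σ.DecodableWithQuery p) : σ.echo.Decodable p := by
  rw [decodable_iff]
  intro W S hp q q' x y hq hq' hxy ha
  obtain ⟨rfl, ha⟩ := Prod.mk.inj ha
  exact (σ.decodableWithQuery_iff p).1 h W S hp q x y hq hxy ha

section PartitionScheme

variable {K M n : ℕ} {block : Fin K → Fin n} {B : Fin K → Finset (Fin K)} 

theorem partitionQuery_apply (hB : ∀ u, u ∉ B u ∧ (B u).card = M) {W : Fin K}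
    {S : Finset (Fin K)} (hW : W ∉ S) (hS : S.card = M) (π : Equiv.Perm (Fin K)) :
    partitionQuery B W S π =
      if S.image π = B (π W) then ((compatible B W S).card : ℝ≥0∞)⁻¹ else 0 := by
  rw [partitionQuery, dif_pos (compatible_nonempty hB hW hS), PMF.uniformOfFinset_apply]
  simp only [mem_compatible]

theorem partitionScheme_decodableWithQuery (hMK : M < K) (hB : ∀ u, u ∉ B u ∧ (B u).card = M)
    (t : ℕ) (hblock : ∀ u j, j ≠ u → block j = block u → j ∈ B u) :
    (partitionScheme block B t).DecodableWithQuery (uniformPairLaw K M hMK) := by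
  rw [Scheme.decodableWithQuery_iff]
  intro W S hp (π : Equiv.Perm (Fin K)) x y hπ hxy ha
  obtain ⟨hW, hS⟩ : W ∉ S ∧ S.card = M :=
    (mem_support_uniformPairLaw hMK).1 ((PMF.mem_support_iff _ _).2 hp)
  have hπ : S.image π = B (π W) := by
    by_contra h
    exact hπ ((partitionQuery_apply hB hW hS π).trans (if_neg h))
  have h : ∑ j with block (π j) = block (π W), x j = ∑ j with block (π j) = block (π W), y j :=
    congrFun ha (block (π W))
  have hmem : W ∈ Finset.univ.filter fun j => block (π j) = block (π W) := by simp
  rw [← Finset.add_sum_erase _ _ hmem, ← Finset.add_sum_erase _ _ hmem] at h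
  have hrest : ∑ j ∈ (Finset.univ.filter fun j => block (π j) = block (π W)).erase W, x j =
      ∑ j ∈ (Finset.univ.filter fun j => block (π j) = block (π W)).erase W, y j := by
    refine Finset.sum_congr rfl fun j hj => ?_
    simp only [Finset.mem_erase, Finset.mem_filter, Finset.mem_univ, true_and] at hj
    have hjB := hblock (π W) (π j) (fun h => hj.1 (π.injective h)) hj.2
    rw [← hπ] at hjB
    obtain ⟨i, hi, hij⟩ := Finset.mem_image.1 hjB
    rw [π.injective hij] at hi
    exact congrFun hxy ⟨j, hi⟩
  rw [hrest] at h
  exact add_right_cancel h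

/-- Only `S = π⁻¹ (B (π W))` is compatible with `W` and `π`, so the sum has a single term, and that
term does not depend on `π`. -/
theorem sum_uniformPairLaw_mul_partitionQuery (hMK : M < K)
    (hB : ∀ u, u ∉ B u ∧ (B u).card = M) (W : Fin K) (π : Equiv.Perm (Fin K)) :
    ∑ S, uniformPairLaw K M hMK (W, S) * partitionQuery B W S π =
      (((K - M) * K.choose M : ℕ) : ℝ≥0∞)⁻¹ *
        ((compatible B W (B W)).card : ℝ≥0∞)⁻¹ := by
  rw [Finset.sum_eq_single ((B (π W)).image π.symm)]
  · have hW : W ∉ (B (π W)).image π.symm := by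
      intro h
      obtain ⟨i, hi, rfl⟩ := Finset.mem_image.1 h
      exact (hB i).1 (by simpa using hi)
    have hS : ((B (π W)).image π.symm).card = M := by
      rw [Finset.card_image_of_injective _ (Equiv.injective _), (hB _).2]
    rw [uniformPairLaw_apply, if_pos ⟨hW, hS⟩, partitionQuery_apply hB hW hS, if_pos,
      card_compatible_eq hW (hB W).1 (hS.trans (hB W).2.symm)]
    rw [Finset.image_image]
    simp
  · intro S _ hne
    by_cases hS : W ∉ S ∧ S.card = M
    · rw [partitionQuery_apply hB hS.1 hS.2, if_neg, mul_zero]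
      intro h
      apply hne
      rw [← h, Finset.image_image]
      simp
    · rw [uniformPairLaw_apply, if_neg hS, zero_mul]
  · simp

/-- The sum is constant in `π`, and its total over all `π` is the probability of the demand; this
identifies the constant without counting compatible permutations. -/
theorem sum_uniformPairLaw_mul_partitionQuery_eq_mul (hMK : M < K)
    (hB : ∀ u, u ∉ B u ∧ (B u).card = M) (W : Fin K) (π : Equiv.Perm (Fin K)) :
    ∑ S, uniformPairLaw K M hMK (W, S) * partitionQuery B W S π =
      (uniformPairLaw K M hMK).map Prod.fst W *
        (Fintype.card (Equiv.Perm (Fin K)) : ℝ≥0∞)⁻¹ := by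
  have h : (uniformPairLaw K M hMK).map Prod.fst W = ∑ π : Equiv.Perm (Fin K),
      ∑ S, uniformPairLaw K M hMK (W, S) * partitionQuery B W S π := by
    rw [Finset.sum_comm, map_fst_apply, tsum_fintype]
    refine Finset.sum_congr rfl fun S _ => ?_
    rw [← Finset.mul_sum, ← tsum_fintype (L := .unconditional _), PMF.tsum_coe, mul_one]
  rw [h]
  simp only [sum_uniformPairLaw_mul_partitionQuery hMK hB, Finset.sum_const, Finset.card_univ,
    nsmul_eq_mul]
  rw [mul_comm (Fintype.card (Equiv.Perm (Fin K)) : ℝ≥0∞), mul_assoc,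
    ENNReal.mul_inv_cancel (by simp [Fintype.card_ne_zero]) (ENNReal.natCast_ne_top _), mul_one]

theorem partitionScheme_wPrivate (hMK : M < K) (hB : ∀ u, u ∉ B u ∧ (B u).card = M) (t : ℕ) :
    (partitionScheme block B t).WPrivate (uniformPairLaw K M hMK) := by
  have : Countable (partitionScheme block B t).Query :=
    inferInstanceAs (Countable (Equiv.Perm (Fin K)))
  have : Countable (partitionScheme block B t).Answer :=
    inferInstanceAs (Countable (Fin n → Msg t))
  exact Scheme.wPrivate_of_demandWeight _ _
    (fun _ => (Fintype.card (Equiv.Perm (Fin K)) : ℝ≥0∞)⁻¹)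
    fun W π _ => sum_uniformPairLaw_mul_partitionQuery_eq_mul hMK hB W π

theorem echo_partitionScheme_wPrivate (hMK : M < K) (hB : ∀ u, u ∉ B u ∧ (B u).card = M) (t : ℕ) :
    (partitionScheme block B t).echo.WPrivate (uniformPairLaw K M hMK) := by
  have : Countable (partitionScheme block B t).echo.Query :=
    inferInstanceAs (Countable (Equiv.Perm (Fin K)))
  have : Countable (partitionScheme block B t).echo.Answer :=
    inferInstanceAs (Countable (Equiv.Perm (Fin K) × (Fin n → Msg t)))
  exact Scheme.wPrivate_of_demandWeight _ _
    (fun _ => (Fintype.card (Equiv.Perm (Fin K)) : ℝ≥0∞)⁻¹)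
    fun W π _ => sum_uniformPairLaw_mul_partitionQuery_eq_mul hMK hB W π

theorem map_fst_uniformPairLaw_pos (hMK : M < K) (W : Fin K) :
    0 < (uniformPairLaw K M hMK).map Prod.fst W := by
  obtain ⟨S, hS, hcard⟩ := Finset.exists_subset_card_eq (n := M) (s := Finset.univ.erase W)
    (by rw [Finset.card_erase_of_mem (Finset.mem_univ _), Finset.card_fin]; omega)
  have hmem : W ∈ ((uniformPairLaw K M hMK).map Prod.fst).support := by
    rw [PMF.mem_support_map_iff]
    exact ⟨(W, S), (mem_support_uniformPairLaw hMK).2 ⟨fun h => by simpa using hS h, hcard⟩, rfl⟩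
  exact pos_iff_ne_zero.2 ((PMF.mem_support_iff _ _).1 hmem)

end PartitionScheme

/-! ### Rates of the schemes and their limit -/

theorem logb_card_answers {t n : ℕ} (ht : 1 ≤ t) :
    Real.logb 2 (Fintype.card (Fin n → Msg t)) = n * t := by
  rw [Fintype.card_fun, card_msg ht, Fintype.card_fin]
  push_cast
  rw [← pow_mul, Real.logb_pow, Real.logb_self_eq_one one_lt_two]
  push_cast
  ring

theorem partitionScheme_rateAt_ge {K n t : ℕ} (block : Fin K → Fin n)
    (B : Fin K → Finset (Fin K)) (ht : 1 ≤ t) (W : Fin K) (S : Finset (Fin K)) :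
    (n : ℝ≥0∞)⁻¹ ≤ (partitionScheme block B t).rateAt W S := by
  have h : entropy ((partitionScheme block B t).answerLaw W S) ≤ n * t := by
    refine (entropy_le_log_card (α := Fin n → Msg t) _).trans ?_
    rw [logb_card_answers ht, ENNReal.ofReal_mul (Nat.cast_nonneg _), ENNReal.ofReal_natCast,
      ENNReal.ofReal_natCast]
  have ht0 : (t : ℝ≥0∞) ≠ 0 := by exact_mod_cast (by omega : t ≠ 0)
  refine le_trans ?_ (ENNReal.div_le_div_left h _)
  rw [ENNReal.div_eq_inv_mul, ENNReal.mul_inv (by simp) (by simp), mul_assoc,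
    ENNReal.inv_mul_cancel ht0 (ENNReal.natCast_ne_top _), mul_one]

theorem echo_partitionScheme_rateAt_ge {K n t : ℕ} (block : Fin K → Fin n)
    (B : Fin K → Finset (Fin K)) (ht : 1 ≤ t) (W : Fin K) (S : Finset (Fin K)) :
    (t : ℝ≥0∞) /
      ENNReal.ofReal (Real.logb 2 (Fintype.card (Equiv.Perm (Fin K))) + n * t) ≤
        (partitionScheme block B t).echo.rateAt W S := by
  refine ENNReal.div_le_div_left ?_ _
  refine (entropy_le_log_card (α := Equiv.Perm (Fin K) × (Fin n → Msg t)) _).trans ?_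
  rw [Fintype.card_prod, Nat.cast_mul, Real.logb_mul (by simp [Fintype.card_ne_zero])
    (by simp), logb_card_answers ht]

theorem tendsto_div_ofReal_add (L : ℝ) (n : ℕ) :
    Filter.Tendsto (fun t : ℕ => (t : ℝ≥0∞) / ENNReal.ofReal (L + (n + 1 : ℕ) * t))
      Filter.atTop (nhds (((n + 1 : ℕ) : ℝ≥0∞)⁻¹)) := by
  have h1 : Filter.Tendsto (fun t : ℕ => ENNReal.ofReal (L / t + (n + 1 : ℕ))) Filter.atTop
      (nhds ((n + 1 : ℕ) : ℝ≥0∞)) := by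
    have := (tendsto_const_div_atTop_nhds_zero_nat L).add_const ((n + 1 : ℕ) : ℝ)
    simpa [-Nat.cast_add] using ENNReal.tendsto_ofReal this
  refine (h1.inv).congr' ?_
  filter_upwards [Filter.eventually_ge_atTop 1] with t ht
  have ht0 : (0 : ℝ) < t := by exact_mod_cast ht
  have h2 : L + (n + 1 : ℕ) * t = t * (L / t + (n + 1 : ℕ)) := by field_simp
  have ht' : (t : ℝ≥0∞) ≠ 0 := by exact_mod_cast (by omega : t ≠ 0)
  rw [h2, ENNReal.ofReal_mul ht0.le, ENNReal.ofReal_natCast, ENNReal.div_eq_inv_mul,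
    ENNReal.mul_inv (Or.inl ht') (Or.inl (ENNReal.natCast_ne_top _)), mul_right_comm,
    ENNReal.inv_mul_cancel ht' (ENNReal.natCast_ne_top _), one_mul]

end PIRSI

open PIRSI in
theorem theorem1 (K M : ℕ) (hMK : M < K) :
    PIRSI.capacity (PIRSI.uniformPairLaw K M hMK) =
        ((⌈(K : ℝ) / ((M : ℝ) + 1)⌉₊ : ℕ) : ENNReal)⁻¹ ∧
    PIRSI.capacityWithQuery (PIRSI.uniformPairLaw K M hMK) =
        ((⌈(K : ℝ) / ((M : ℝ) + 1)⌉₊ : ℕ) : ENNReal)⁻¹ ∧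
    (∀ t : ℕ, 1 ≤ t → ∃ σ : PIRSI.Scheme K t,
      σ.DecodableWithQuery (PIRSI.uniformPairLaw K M hMK) ∧
      σ.WPrivate (PIRSI.uniformPairLaw K M hMK) ∧
      ∀ ws ∈ (PIRSI.uniformPairLaw K M hMK).support,
        σ.rateAt ws.1 ws.2 = ((⌈(K : ℝ) / ((M : ℝ) + 1)⌉₊ : ℕ) : ENNReal)⁻¹) ∧
    (∀ p : PMF (Fin K × Finset (Fin K)),
      (∀ W : Fin K, 0 < p.map Prod.fst W) →
      (∀ ws ∈ p.support, ws.1 ∉ ws.2 ∧ ws.2.card = M) →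
      ∀ t : ℕ, 1 ≤ t → ∀ σ : PIRSI.Scheme K t,
        σ.DecodableWithQuery p → σ.WPrivate p →
        ∀ ws ∈ p.support,
          σ.rateAt ws.1 ws.2 ≤ ((⌈(K : ℝ) / ((M : ℝ) + 1)⌉₊ : ℕ) : ENNReal)⁻¹) := by
  have hpos := map_fst_uniformPairLaw_pos hMK
  have hadm : ∀ ws ∈ (uniformPairLaw K M hMK).support, ws.1 ∉ ws.2 ∧ ws.2.card = M :=
    fun ws => (mem_support_uniformPairLaw hMK).1
  have hrate : ∀ t : ℕ, 1 ≤ t → ∀ σ : Scheme K t,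
      σ.DecodableWithQuery (uniformPairLaw K M hMK) → σ.WPrivate (uniformPairLaw K M hMK) →
      σ.rate (uniformPairLaw K M hMK) ≤ ((⌈(K : ℝ) / ((M : ℝ) + 1)⌉₊ : ℕ) : ENNReal)⁻¹ := by
    intro t ht σ hdec hpriv
    obtain ⟨ws, hws⟩ := (uniformPairLaw K M hMK).support_nonempty
    exact (iInf₂_le ws hws).trans (rateAt_le hMK hpos hadm ht hdec hpriv hws)
  obtain ⟨n, hn, -, hK⟩ := exists_ceil_eq_succ hMK
  obtain ⟨block, B, hB, hblock⟩ := exists_cover_blocks hMK hK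
  have hdec := fun t => partitionScheme_decodableWithQuery hMK hB t hblock
  have hpriv := fun t => partitionScheme_wPrivate (block := block) hMK hB t
  refine ⟨le_antisymm ?_ ?_, le_antisymm ?_ ?_, ?_, ?_⟩
  · exact iSup₂_le fun t ht => iSup_le fun σ => iSup₂_le fun hd hp =>
      hrate t ht σ hd.decodableWithQuery hp
  · rw [hn]
    -- The schemes that repeat the query are only shown to approach the bound as `t → ∞`, so the
    -- capacity is compared with a limit of rates. When the query may be used for decoding, `t = 1`
    -- already suffices.
    refine le_of_tendsto
      (tendsto_div_ofReal_add (Real.logb 2 (Fintype.card (Equiv.Perm (Fin K)))) n) ?_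
    filter_upwards [Filter.eventually_ge_atTop 1] with t ht
    refine le_trans (le_iInf₂ fun ws _ => ?_) (le_iSup₂_of_le t ht <|
      le_iSup_of_le (partitionScheme block B t).echo <|
        le_iSup₂_of_le (Scheme.decodable_echo (hdec t)) (echo_partitionScheme_wPrivate hMK hB t)
          le_rfl)
    exact echo_partitionScheme_rateAt_ge block B ht ws.1 ws.2
  · exact iSup₂_le fun t ht => iSup_le fun σ => iSup₂_le fun hd hp => hrate t ht σ hd hp
  · rw [hn]
    refine le_trans (le_iInf₂ fun ws _ => ?_) (le_iSup₂_of_le 1 le_rfl <|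
      le_iSup_of_le (partitionScheme block B 1) <|
        le_iSup₂_of_le (hdec 1) (hpriv 1) le_rfl)
    exact partitionScheme_rateAt_ge block B le_rfl ws.1 ws.2
  · intro t ht
    refine ⟨partitionScheme block B t, hdec t, hpriv t, fun ws hws => le_antisymm
      (rateAt_le hMK hpos hadm ht (hdec t) (hpriv t) hws) ?_⟩
    rw [hn]
    exact partitionScheme_rateAt_ge block B ht ws.1 ws.2
  · intro p hpos hadm t ht σ hd hp ws hws
    exact rateAt_le hMK hpos hadm ht hd hp hws
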